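/- Let $n\ge 1$ and let $\alpha_1,\dots,\alpha_n$ be the simple roots of the root system of type $\mathbb{A}_n$. Identify the root lattice with $\mathbb{Z}^n$ by sending $\alpha_i$ to the standard basis vector $e_i$, so that the positive roots are $\Phi^+=\{e_i+e_{i+1}+\cdots+e_j : 1\le i\le j\le n\}$. Put $\Phi^{\mathrm{clus}}=\Phi^+\cup\{-e_1,\dots,-e_n\}$ and $\Phi=\Phi^+\cup(-\Phi^+)$, and define the polytopes in $\mathbb{R}^n$ $$C(\mathbb{A}_n)=\mathrm{conv}(\Phi),\qquad C^{\mathrm{clus}}(\mathbb{A}_n)=\mathrm{conv}(\Phi^{\mathrm{clus}}),\qquad C^{+}(\mathbb{A}_n)=\mathrm{conv}(\Phi^+\cup\{0\}).$$ Let $\mathrm{vol}$ denote the normalised (integral) volume on $\mathbb{R}^n$, that is, $n!$ times Lebesgue measure, and let $C_m$ denote the $m$-th Catalan number ($C_0=1$, $C_{m+1}=\sum_{i=0}^{m}C_iC_{m-i}$). Then $$\mathrm{vol}\,C(\mathbb{A}_n)=\binom{2n}{n}=(n+1)C_n,\qquad \mathrm{vol}\,C^{\mathrm{clus}}(\mathbb{A}_n)=\frac{1}{n+2}\binom{2n+2}{n+1}=C_{n+1},\qquad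 \mathrm{vol}\,C^{+}(\mathbb{A}_n)=\frac{1}{n+1}\binom{2n}{n}=C_n.$$ -/

import Mathlib

open MeasureTheory
open scoped ENNReal Nat

namespace RootPolytopeA

/-- The root `α_i + ⋯ + α_j` of type `A_n`, written in coordinates with respect to the simple
roots `α_0, …, α_{n-1}`: the indicator vector of the interval `[i, j]`. -/
def intervalRoot {n : ℕ} (i j : Fin n) : Fin n → ℝ :=
  fun k => if i ≤ k ∧ k ≤ j then 1 else 0

/-- The set `Φ⁺` of positive roots of type `A_n`. -/
def positiveRoots (n : ℕ) : Set (Fin n → ℝ) :=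
  {v | ∃ i j : Fin n, i ≤ j ∧ v = intervalRoot i j}

/-- The set `Φ^clus` of almost positive roots: the positive roots and the negative simple
roots. -/
def almostPositiveRoots (n : ℕ) : Set (Fin n → ℝ) :=
  positiveRoots n ∪ {v | ∃ i : Fin n, v = -Pi.single i 1}

/-- The set `Φ` of all roots of type `A_n`. -/
def roots (n : ℕ) : Set (Fin n → ℝ) :=
  positiveRoots n ∪ {v | -v ∈ positiveRoots n}

/-- The polytope `C(A_n)`, the convex hull of all roots. -/
def polytopeC (n : ℕ) : Set (Fin n → ℝ) :=
  convexHull ℝ (roots n)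

/-- The polytope `C^clus(A_n)`, the convex hull of the almost positive roots. -/
def polytopeCclus (n : ℕ) : Set (Fin n → ℝ) :=
  convexHull ℝ (almostPositiveRoots n)

/-- The polytope `C⁺(A_n)`, the convex hull of the origin and the positive roots. -/
def polytopeCplus (n : ℕ) : Set (Fin n → ℝ) :=
  convexHull ℝ (insert 0 (positiveRoots n))

/-- The integral (normalised) volume on `ℝⁿ`: `n!` times Lebesgue measure, so that a simplex
spanned by the origin and a basis of `ℤⁿ` has volume `1`. -/
noncomputable def integralVolume {n : ℕ} (S : Set (Fin n → ℝ)) : ℝ≥0∞ :=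
  (n ! : ℝ≥0∞) * volume S

end RootPolytopeA

/-! Each polytope is the unit ball of a gauge. For `polytopeC` the gauge is `ascent 0 x`, the total
increase of the path `0, x 0, …, x (n - 1), 0`; `polytopeCplus` is the part of that ball in the
nonnegative orthant; for `polytopeCclus` the gauge is the ascent of the positive part plus the sum
of the negative part (`polytopeC_eq`, `polytopeCplus_eq`, `polytopeCclus_eq`). The roots lie in the
ball, which gives one inclusion. The other is Hahn–Banach: a functional whose coefficients have
partial sums `S` takes the value `S (j + 1) - S i` on a positive root, and summation by parts bounds
it by a multiple of the gauge.

By `integralVolume_gauge` the normalised volume is the integral of `exp (-g)`. The ascent is a sum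
over consecutive entries, so with a free starting value `a ≥ 0` this integral is computed one
coordinate at a time. The results are polynomials in `a`; passing from `P` to the next one `Q` is
governed by `Q' - Q'' = P` and a condition at `0` that depends on the polytope. The solutions are
`rootPoly n`, `positivePoly n` and `derivative (positivePoly (n + 1))`, whose values at `0` are the
central binomial coefficient, `catalan n` and `catalan (n + 1)`. -/

namespace RootPolytopeA

/-! ### The ascent of a path -/

/-- The total increase along the path that starts at `a`, runs through the entries of `x`, and
ends at `0`. -/
def ascent : {n : ℕ} → ℝ → (Fin n → ℝ) → ℝ
  | 0, a, _ => max (-a) 0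
  | _ + 1, a, x => max (x 0 - a) 0 + ascent (x 0) (Fin.tail x)

lemma ascent_zero_dim (a : ℝ) (x : Fin 0 → ℝ) : ascent a x = max (-a) 0 := rfl

lemma ascent_succ {n : ℕ} (a : ℝ) (x : Fin (n + 1) → ℝ) :
    ascent a x = max (x 0 - a) 0 + ascent (x 0) (Fin.tail x) := rfl

lemma continuous_ascent {n : ℕ} :
    Continuous fun p : ℝ × (Fin n → ℝ) => ascent p.1 p.2 := by
  induction n with
  | zero => simp only [ascent_zero_dim]; fun_prop
  | succ n ih =>
    simp only [ascent_succ]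
    refine Continuous.add (by fun_prop) (ih.comp (f := fun p : ℝ × (Fin (n + 1) → ℝ) =>
      (p.2 0, Fin.tail p.2)) ?_)
    unfold Fin.tail
    fun_prop

lemma ascent_nonneg {n : ℕ} (a : ℝ) (x : Fin n → ℝ) : 0 ≤ ascent a x := by
  induction n generalizing a with
  | zero => exact le_max_right _ _
  | succ n ih => exact add_nonneg (le_max_right _ _) (ih _ _)

lemma ascent_add_le {n : ℕ} (a b : ℝ) (x y : Fin n → ℝ) :
    ascent (a + b) (x + y) ≤ ascent a x + ascent b y := by
  induction n generalizing a b with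
  | zero =>
    simp only [ascent_zero_dim]
    exact max_le (by linarith [le_max_left (-a) 0, le_max_left (-b) 0])
      (by linarith [le_max_right (-a) 0, le_max_right (-b) 0])
  | succ n ih =>
    simp only [ascent_succ]
    have h := ih (x 0) (y 0) (Fin.tail x) (Fin.tail y)
    have h' : max ((x + y) 0 - (a + b)) 0 ≤ max (x 0 - a) 0 + max (y 0 - b) 0 :=
      max_le (by simp only [Pi.add_apply]
                 linarith [le_max_left (x 0 - a) 0, le_max_left (y 0 - b) 0])
        (by linarith [le_max_right (x 0 - a) 0, le_max_right (y 0 - b) 0])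
    have h'' : Fin.tail (x + y) = Fin.tail x + Fin.tail y := rfl
    rw [h'']
    simp only [Pi.add_apply] at *
    linarith

lemma ascent_smul {n : ℕ} {t : ℝ} (ht : 0 ≤ t) (a : ℝ) (x : Fin n → ℝ) :
    ascent (t * a) (t • x) = t * ascent a x := by
  induction n generalizing a with
  | zero => simp only [ascent_zero_dim, mul_max_of_nonneg _ _ ht]; simp
  | succ n ih =>
    have h : Fin.tail (t • x) = t • Fin.tail x := rfl
    simp only [ascent_succ, h, Pi.smul_apply, smul_eq_mul, ih, mul_add,
      mul_max_of_nonneg _ _ ht, mul_sub, mul_zero]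

lemma ascent_zero_smul {n : ℕ} {t : ℝ} (ht : 0 ≤ t) (x : Fin n → ℝ) :
    ascent 0 (t • x) = t * ascent 0 x := by
  simpa using ascent_smul ht 0 x

/-- Negation turns increases into decreases, and increase minus decrease is the net change `-a` of a
path from `a` to `0`. -/
lemma ascent_neg {n : ℕ} (a : ℝ) (x : Fin n → ℝ) : ascent (-a) (-x) = ascent a x + a := by
  induction n generalizing a with
  | zero =>
    simp only [ascent_zero_dim, neg_neg]
    rcases le_total a 0 with h | h <;> simp [h]
  | succ n ih =>
    have h : Fin.tail (-x) = -Fin.tail x := rfl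
    simp only [ascent_succ, h, Pi.neg_apply, ih]
    rcases le_total a (x 0) with h | h
    · rw [max_eq_right (by linarith), max_eq_left (by linarith)]; ring
    · rw [max_eq_left (by linarith), max_eq_right (by linarith)]; ring

/-- Lowering one entry by `r i` can enlarge only the step that leaves it, and by at most `r i`. -/
lemma ascent_sub_le {n : ℕ} (a c : ℝ) (hc : 0 ≤ c) (x r : Fin n → ℝ) (hr : 0 ≤ r) :
    ascent (a - c) (x - r) ≤ ascent a x + c + ∑ i, r i := by
  induction n generalizing a c with
  | zero =>
    simp only [ascent_zero_dim]
    refine max_le ?_ ?_ <;> simp <;> linarith [le_max_left (-a) 0, le_max_right (-a) 0]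
  | succ n ih =>
    have h := ih (x 0) (r 0) (hr 0) (Fin.tail x) (Fin.tail r) (fun i => hr _)
    have h'' : Fin.tail (x - r) = Fin.tail x - Fin.tail r := rfl
    have h' : max ((x - r) 0 - (a - c)) 0 ≤ max (x 0 - a) 0 + c := by
      have := hr 0
      simp only [Pi.sub_apply, Pi.zero_apply] at *
      exact max_le (by linarith [le_max_left (x 0 - a) 0]) (by linarith [le_max_right (x 0 - a) 0])
    rw [ascent_succ, ascent_succ, h'', Fin.sum_univ_succ]
    simp only [Pi.sub_apply, Fin.tail] at *
    linarith

lemma ascent_zero {n : ℕ} : ascent 0 (0 : Fin n → ℝ) = 0 := by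
  simpa using ascent_zero_smul (n := n) le_rfl 0

lemma ascent_initial {n : ℕ} (j : ℕ) :
    ascent 1 (fun k : Fin n => if (k : ℕ) < j then (1 : ℝ) else 0) = 0 := by
  induction n generalizing j with
  | zero => simp [ascent_zero_dim]
  | succ n ih =>
    rw [ascent_succ]
    cases j with
    | zero =>
      have : Fin.tail (fun k : Fin (n + 1) => if (k : ℕ) < 0 then (1 : ℝ) else 0) = 0 := by
        ext; simp [Fin.tail]
      rw [this]; simp [ascent_zero]
    | succ j =>
      have : Fin.tail (fun k : Fin (n + 1) => if (k : ℕ) < j + 1 then (1 : ℝ) else 0) =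
          fun k : Fin n => if (k : ℕ) < j then (1 : ℝ) else 0 := by
        ext; simp [Fin.tail]
      rw [this]; simp [ih]

lemma ascent_interval {n : ℕ} (i j : ℕ) :
    ascent 0 (fun k : Fin n => if i ≤ (k : ℕ) ∧ (k : ℕ) < j then (1 : ℝ) else 0) ≤ 1 := by
  induction n generalizing i j with
  | zero => simp [ascent_zero_dim]
  | succ n ih =>
    cases j with
    | zero =>
      have : (fun k : Fin (n + 1) => if i ≤ (k : ℕ) ∧ (k : ℕ) < 0 then (1 : ℝ) else 0) = 0 := by
        ext; simp
      rw [this, ascent_zero]; exact zero_le_one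
    | succ j =>
      rw [ascent_succ]
      cases i with
      | zero =>
        have : Fin.tail (fun k : Fin (n + 1) => if 0 ≤ (k : ℕ) ∧ (k : ℕ) < j + 1
            then (1 : ℝ) else 0) = fun k : Fin n => if (k : ℕ) < j then (1 : ℝ) else 0 := by
          ext; simp [Fin.tail]
        rw [this]; simp [ascent_initial]
      | succ i =>
        have : Fin.tail (fun k : Fin (n + 1) => if i + 1 ≤ (k : ℕ) ∧ (k : ℕ) < j + 1
            then (1 : ℝ) else 0) =
            fun k : Fin n => if i ≤ (k : ℕ) ∧ (k : ℕ) < j then (1 : ℝ) else 0 := by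
          ext; simp [Fin.tail]
        rw [this]; simpa using ih i j

lemma ascent_intervalRoot {n : ℕ} (i j : Fin n) : ascent 0 (intervalRoot i j) ≤ 1 := by
  have : intervalRoot i j =
      fun k : Fin n => if (i : ℕ) ≤ k ∧ (k : ℕ) < j + 1 then (1 : ℝ) else 0 := by
    ext k
    exact if_congr (by rw [Fin.le_def, Fin.le_def, Nat.lt_succ_iff]) rfl rfl
  rw [this]
  exact ascent_interval _ _

/-! ### Linear functionals bounded by the ascent -/

/-- Upper bound for a linear functional in terms of the ascent, when the path may be negative. -/
lemma sum_mul_le_ascent {n : ℕ} (S : ℕ → ℝ) (M m a : ℝ) (x : Fin n → ℝ) (hm : 0 ≤ m)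
    (hmM : m ≤ M) (h : ∀ j ≤ n, S j - S 0 ≤ m ∧ m - M ≤ S j - S 0) :
    ∑ k : Fin n, (S (k + 1) - S k) * x k ≤ M * ascent a x + m * a := by
  induction n generalizing S m a with
  | zero =>
    simp only [ascent_zero_dim, Finset.univ_eq_empty, Finset.sum_empty]
    rcases le_total a 0 with h | h
    · rw [max_eq_left (by linarith)]; nlinarith
    · rw [max_eq_right (by linarith)]; nlinarith
  | succ n ih =>
    have h1 := h 1 (by omega)
    -- Summation by parts: step `k` of the path has weight `m - (S k - S 0)`, which the hypotheses
    -- keep in `[0, M]`. The new `m` is the next weight.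
    have := ih (fun k => S (k + 1)) (m - (S 1 - S 0)) (x 0) (Fin.tail x) (by linarith)
      (by linarith) (fun j hj => by
        have := h (j + 1) (by omega)
        constructor <;> simp only [zero_add] <;> linarith)
    rw [Fin.sum_univ_succ, ascent_succ]
    simp only [Fin.tail, Fin.val_succ, Fin.val_zero, zero_add] at *
    have h2 : m * (x 0 - a) ≤ M * max (x 0 - a) 0 :=
      (mul_le_mul_of_nonneg_left (le_max_left _ 0) hm).trans
        (mul_le_mul_of_nonneg_right hmM (le_max_right _ _))
    linarith

/-- Upper bound for a linear functional in terms of the ascent, along a nonnegative path. -/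
lemma sum_mul_le_ascent_of_nonneg {n : ℕ} (S : ℕ → ℝ) (M m a : ℝ) (x : Fin n → ℝ) (hx : 0 ≤ x)
    (ha : 0 ≤ a) (hm : 0 ≤ m) (hmM : m ≤ M) (h : ∀ j ≤ n, S j - S 0 ≤ m)
    (h' : ∀ i j, i ≤ j → j ≤ n → S j - S i ≤ M) :
    ∑ k : Fin n, (S (k + 1) - S k) * x k ≤ M * ascent a x + m * a := by
  induction n generalizing S m a with
  | zero =>
    simp only [ascent_zero_dim, Finset.univ_eq_empty, Finset.sum_empty]
    exact add_nonneg (mul_nonneg (hm.trans hmM) (le_max_right _ _)) (mul_nonneg hm ha)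
  | succ n ih =>
    have h1 := h 1 (by omega)
    have hx0 : 0 ≤ x 0 := hx 0
    -- Only forward differences of `S` are bounded here, so the next weight may exceed `M`. It is
    -- truncated at `M`, which is harmless because `x 0 ≥ 0`.
    have := ih (fun k => S (k + 1)) (min M (m - (S 1 - S 0))) (x 0) (Fin.tail x)
      (fun i => hx _) hx0 (le_min (by linarith) (by linarith)) (min_le_left _ _)
      (fun j hj => le_min (h' _ _ (by omega) (by omega))
        (by simp only [zero_add]; linarith [h (j + 1) (by omega)]))
      (fun i j hi hj => h' _ _ (by omega) (by omega))
    rw [Fin.sum_univ_succ, ascent_succ]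
    simp only [Fin.tail, Fin.val_succ, Fin.val_zero, zero_add] at *
    have h2 : m * (x 0 - a) ≤ M * max (x 0 - a) 0 :=
      (mul_le_mul_of_nonneg_left (le_max_left _ 0) hm).trans
        (mul_le_mul_of_nonneg_right hmM (le_max_right _ _))
    have h3 := mul_le_mul_of_nonneg_right (min_le_right M (m - (S 1 - S 0))) hx0
    linarith

/-! ### The polytopes as unit balls of gauges -/

lemma intervalRoot_nonneg {n : ℕ} (i j : Fin n) : 0 ≤ intervalRoot i j := by
  intro k
  simp only [intervalRoot, Pi.zero_apply]
  split_ifs <;> norm_num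

lemma intervalRoot_self {n : ℕ} (i : Fin n) : intervalRoot i i = Pi.single i 1 := by
  ext k
  simp only [intervalRoot, Pi.single_apply]
  exact if_congr ⟨fun h => le_antisymm h.2 h.1, fun h => ⟨h.ge, h.le⟩⟩ rfl rfl

lemma finite_positiveRoots (n : ℕ) : (positiveRoots n).Finite :=
  (Set.finite_range fun p : Fin n × Fin n => intervalRoot p.1 p.2).subset
    fun _ ⟨i, j, _, h⟩ => ⟨(i, j), h.symm⟩

lemma finite_roots (n : ℕ) : (roots n).Finite :=
  (finite_positiveRoots n).union ((finite_positiveRoots n).preimage neg_injective.injOn)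

lemma finite_almostPositiveRoots (n : ℕ) : (almostPositiveRoots n).Finite :=
  (finite_positiveRoots n).union <|
    (Set.finite_range fun i : Fin n => -Pi.single (M := fun _ => ℝ) i 1).subset
      fun _ ⟨i, h⟩ => ⟨i, h.symm⟩

lemma sum_mul_intervalRoot {n : ℕ} (S : ℕ → ℝ) (i j : Fin n) (hij : i ≤ j) :
    ∑ k : Fin n, (S (k + 1) - S k) * intervalRoot i j k = S (j + 1) - S i := by
  have h := Fin.sum_univ_eq_sum_range
    (fun k => (S (k + 1) - S k) * if (i : ℕ) ≤ k ∧ k ≤ (j : ℕ) then 1 else 0) n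
  simp only [intervalRoot, Fin.le_def]
  rw [h]
  simp only [mul_ite, mul_one, mul_zero]
  rw [← Finset.sum_filter]
  have : (Finset.range n).filter (fun k => (i : ℕ) ≤ k ∧ k ≤ (j : ℕ)) =
      Finset.Ico (i : ℕ) (j + 1) := by
    ext k
    have := j.isLt
    simp only [Finset.mem_filter, Finset.mem_range, Finset.mem_Ico]
    omega
  rw [this, Finset.sum_Ico_eq_sub _ (by have := Fin.le_def.1 hij; omega),
    Finset.sum_range_sub, Finset.sum_range_sub]
  ring

/-- Hahn–Banach separation, with the functional encoded by the partial sums `S` of its coefficients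
because root values are then differences of `S`. Having `0` in the hull allows the restriction to `0
≤ M`. -/
lemma mem_convexHull_of_sum_le {n : ℕ} {V : Set (Fin n → ℝ)} (hV : V.Finite)
    (h0 : 0 ∈ convexHull ℝ V) (x : Fin n → ℝ)
    (h : ∀ (S : ℕ → ℝ) (M : ℝ), 0 ≤ M → (∀ v ∈ V, ∑ k : Fin n, (S (k + 1) - S k) * v k ≤ M) →
      ∑ k : Fin n, (S (k + 1) - S k) * x k ≤ M) : x ∈ convexHull ℝ V := by
  by_contra hx
  obtain ⟨f, u, hf, hu⟩ :=
    geometric_hahn_banach_closed_point (convex_convexHull ℝ V) (hV.isClosed_convexHull ℝ) hx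
  set F : ℕ → ℝ := fun i => if h : i < n then f (Pi.single ⟨i, h⟩ 1) else 0 with hF
  have key : ∀ v : Fin n → ℝ, ∑ k : Fin n, ((∑ i ∈ Finset.range (k + 1), F i) -
      ∑ i ∈ Finset.range k, F i) * v k = f v := by
    intro v
    have := LinearMap.pi_apply_eq_sum_univ f.toLinearMap v
    simp only [ContinuousLinearMap.coe_coe, smul_eq_mul] at this
    rw [this]
    refine Finset.sum_congr rfl fun k _ => ?_
    rw [Finset.sum_range_succ, add_sub_cancel_left, mul_comm]
    congr 1
    simp only [hF, k.isLt, dif_pos]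
    congr 1
    ext i
    simp [Pi.single_apply, eq_comm]
  have hu0 : 0 ≤ u := by simpa using (hf 0 h0).le
  have := h (fun k => ∑ i ∈ Finset.range k, F i) u hu0 fun v hv => by
    rw [key]; exact (hf v (subset_convexHull ℝ V hv)).le
  rw [key] at this
  linarith

lemma sub_le_of_forall_positiveRoots {n : ℕ} {S : ℕ → ℝ} {M : ℝ} (hM : 0 ≤ M)
    (h : ∀ v ∈ positiveRoots n, ∑ k : Fin n, (S (k + 1) - S k) * v k ≤ M)
    (i j : ℕ) (hij : i ≤ j) (hj : j ≤ n) : S j - S i ≤ M := by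
  rcases hij.eq_or_lt with rfl | hlt
  · simpa using hM
  · obtain ⟨j, rfl⟩ : ∃ l, j = l + 1 := ⟨j - 1, by omega⟩
    have hle : (⟨i, by omega⟩ : Fin n) ≤ ⟨j, by omega⟩ := Fin.mk_le_mk.2 (by omega)
    have := h _ ⟨_, _, hle, rfl⟩
    rwa [sum_mul_intervalRoot _ _ _ hle] at this

lemma zero_mem_convexHull_of_neg {n : ℕ} {V : Set (Fin n → ℝ)} {v : Fin n → ℝ} (h : v ∈ V)
    (h' : -v ∈ V) : 0 ∈ convexHull ℝ V := by
  have := (convex_convexHull ℝ V) (subset_convexHull ℝ V h) (subset_convexHull ℝ V h')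
    (by norm_num : (0 : ℝ) ≤ 1 / 2) (by norm_num : (0 : ℝ) ≤ 1 / 2) (by norm_num)
  simpa using this

lemma convex_ascent_le_one (n : ℕ) : Convex ℝ {x : Fin n → ℝ | ascent 0 x ≤ 1} := by
  intro x hx y hy s t hs ht hst
  simp only [Set.mem_ofPred_eq] at *
  have := ascent_add_le 0 0 (s • x) (t • y)
  rw [add_zero, ascent_zero_smul hs, ascent_zero_smul ht] at this
  nlinarith

lemma polytopeCplus_eq (n : ℕ) : polytopeCplus n = {x | 0 ≤ x} ∩ {x | ascent 0 x ≤ 1} := by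
  refine Set.Subset.antisymm (convexHull_min ?_ ((convex_Ici 0).inter (convex_ascent_le_one n))) ?_
  · rintro v (rfl | ⟨i, j, -, rfl⟩)
    · exact ⟨le_refl (0 : Fin n → ℝ), by simp [ascent_zero]⟩
    · exact ⟨intervalRoot_nonneg i j, ascent_intervalRoot i j⟩
  · rintro x ⟨hx, hx1⟩
    refine mem_convexHull_of_sum_le ((finite_positiveRoots n).insert 0)
      (subset_convexHull ℝ _ (Set.mem_insert _ _)) x fun S M hM h => ?_
    have h' := sub_le_of_forall_positiveRoots hM fun v hv => h v (Set.mem_insert_of_mem _ hv)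
    have := sum_mul_le_ascent_of_nonneg S M M 0 x hx le_rfl hM le_rfl
      (fun j hj => h' 0 j (by omega) hj) h'
    simp only [Set.mem_ofPred_eq] at hx1
    nlinarith

lemma polytopeC_eq {n : ℕ} (hn : 1 ≤ n) : polytopeC n = {x | ascent 0 x ≤ 1} := by
  refine Set.Subset.antisymm (convexHull_min ?_ (convex_ascent_le_one n)) fun x hx1 => ?_
  · rintro v (⟨i, j, -, rfl⟩ | ⟨i, j, -, h⟩)
    · exact ascent_intervalRoot i j
    · have := ascent_neg 0 v
      rw [neg_zero, add_zero, h] at this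
      simpa [← this] using ascent_intervalRoot i j
  · have h0 : intervalRoot (⟨0, hn⟩ : Fin n) ⟨0, hn⟩ ∈ positiveRoots n := ⟨_, _, le_rfl, rfl⟩
    refine mem_convexHull_of_sum_le (finite_roots n)
      (zero_mem_convexHull_of_neg (Or.inl h0) (Or.inr (by simpa using h0))) x fun S M hM h => ?_
    have h1 := sub_le_of_forall_positiveRoots hM fun v hv => h v (Or.inl hv)
    -- The negative roots bound the backward differences of `S`.
    have h2 := sub_le_of_forall_positiveRoots (S := fun k => -S k) hM fun v hv => by
      have := h (-v) (Or.inr (by simpa using hv))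
      simp only [Pi.neg_apply] at this
      refine le_trans (le_of_eq (Finset.sum_congr rfl fun k _ => ?_)) this
      ring
    have h3 : ∀ i ≤ n, ∀ j ≤ n, S j - S i ≤ M := by
      intro i hi j hj
      rcases le_total i j with hij | hij
      · exact h1 i j hij hj
      · linarith [h2 j i hij hi]
    -- All values of `S` on `0, …, n` lie in a window of length `M` below `S l`, so `S l - S 0` is
    -- an admissible `m`.
    obtain ⟨l, hl, hmax⟩ := Finset.exists_max_image (Finset.range (n + 1)) S ⟨0, by simp⟩
    simp only [Finset.mem_range, Nat.lt_succ_iff] at hl hmax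
    have := sum_mul_le_ascent S M (S l - S 0) 0 x (by linarith [hmax 0 (by omega)])
      (h3 0 (by omega) l hl)
      (fun j hj => ⟨by linarith [hmax j hj], by linarith [h3 j hj l hl]⟩)
    simp only [Set.mem_ofPred_eq] at hx1
    nlinarith

/-- The gauge of the cluster polytope. -/
def clusterGauge {n : ℕ} (x : Fin n → ℝ) : ℝ :=
  ascent 0 (fun i => max (x i) 0) + ∑ i, max (-x i) 0

/-- The positive and negative parts are the cheapest decomposition: removing `p ⊓ q` from both `p`
and `q` saves in the second term at least what it costs in the ascent. -/
lemma clusterGauge_sub_le {n : ℕ} (p q : Fin n → ℝ) (hp : 0 ≤ p) (hq : 0 ≤ q) :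
    clusterGauge (p - q) ≤ ascent 0 p + ∑ i, q i := by
  have h := ascent_sub_le 0 0 le_rfl p (p ⊓ q) (le_inf hp hq)
  have h1 : (fun i => max ((p - q) i) 0) = p - p ⊓ q := by
    ext i
    simp only [Pi.sub_apply, Pi.inf_apply]
    rcases le_total (p i) (q i) with h | h
    · rw [max_eq_right (by linarith), inf_eq_left.2 h]; ring
    · rw [max_eq_left (by linarith), inf_eq_right.2 h]
  have h2 : ∑ i, max (-(p - q) i) 0 = ∑ i, q i - ∑ i, (p ⊓ q) i := by
    rw [← Finset.sum_sub_distrib]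
    refine Finset.sum_congr rfl fun i _ => ?_
    simp only [Pi.sub_apply, Pi.inf_apply]
    rcases le_total (p i) (q i) with h | h
    · rw [max_eq_left (by linarith), inf_eq_left.2 h]; ring
    · rw [max_eq_right (by linarith), inf_eq_right.2 h]; ring
  rw [clusterGauge, h1, h2]
  rw [sub_zero] at h
  linarith

lemma polytopeCclus_eq {n : ℕ} (hn : 1 ≤ n) : polytopeCclus n = {x | clusterGauge x ≤ 1} := by
  refine Set.Subset.antisymm (fun x hx => ?_) fun x hx1 => ?_
  -- Convexity of `clusterGauge` is never shown directly; differences `p - q` of bounded cost form a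
  -- convex set, since the cost is subadditive in the pair.
  · suffices h : polytopeCclus n ⊆ {x | ∃ p q : Fin n → ℝ, 0 ≤ p ∧ 0 ≤ q ∧
        ascent 0 p + ∑ i, q i ≤ 1 ∧ x = p - q} by
      obtain ⟨p, q, hp, hq, h1, rfl⟩ := h hx
      exact (clusterGauge_sub_le p q hp hq).trans h1
    refine convexHull_min ?_ ?_
    · rintro v (⟨i, j, -, rfl⟩ | ⟨i, rfl⟩)
      · exact ⟨_, 0, intervalRoot_nonneg i j, le_rfl, by simpa using ascent_intervalRoot i j,
          by simp⟩
      · refine ⟨0, Pi.single i 1, le_rfl, ?_, by simp [ascent_zero], by simp⟩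
        rw [← intervalRoot_self]; exact intervalRoot_nonneg i i
    · rintro x ⟨p, q, hp, hq, h, rfl⟩ y ⟨p', q', hp', hq', h', rfl⟩ s t hs ht hst
      refine ⟨s • p + t • p', s • q + t • q', add_nonneg (smul_nonneg hs hp) (smul_nonneg ht hp'),
        add_nonneg (smul_nonneg hs hq) (smul_nonneg ht hq'), ?_, ?_⟩
      · have := ascent_add_le 0 0 (s • p) (t • p')
        rw [add_zero, ascent_zero_smul hs, ascent_zero_smul ht] at this
        simp only [Pi.add_apply, Pi.smul_apply, smul_eq_mul, Finset.sum_add_distrib,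
          ← Finset.mul_sum]
        nlinarith
      · ext i; simp; ring
  · have h0 : intervalRoot (⟨0, hn⟩ : Fin n) ⟨0, hn⟩ ∈ positiveRoots n := ⟨_, _, le_rfl, rfl⟩
    refine mem_convexHull_of_sum_le (finite_almostPositiveRoots n)
      (zero_mem_convexHull_of_neg (Or.inl h0) (Or.inr ⟨_, by rw [intervalRoot_self]⟩)) x
      fun S M hM h => ?_
    have h1 := sub_le_of_forall_positiveRoots hM fun v hv => h v (Or.inl hv)
    have h2 : ∀ i : Fin n, -(S (i + 1) - S i) ≤ M := fun i => by
      have := h _ (Or.inr ⟨i, rfl⟩)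
      simp only [← intervalRoot_self, Pi.neg_apply, mul_neg, Finset.sum_neg_distrib] at this
      rwa [sum_mul_intervalRoot S i i le_rfl] at this
    have h3 := sum_mul_le_ascent_of_nonneg S M M 0 (fun i => max (x i) 0)
      (fun i => le_max_right _ _) le_rfl hM le_rfl (fun j hj => h1 0 j (by omega) hj) h1
    -- The negative simple roots give each coefficient the lower bound `-M`, so the negative part of
    -- `x` costs at most `M` per unit.
    have h4 : ∑ k : Fin n, (S (k + 1) - S k) * x k ≤
        ∑ k : Fin n, (S (k + 1) - S k) * max (x k) 0 + M * ∑ k, max (-x k) 0 := by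
      rw [Finset.mul_sum, ← Finset.sum_add_distrib]
      refine Finset.sum_le_sum fun k _ => ?_
      have := h2 k
      rcases le_total (x k) 0 with hk | hk
      · rw [max_eq_right hk, max_eq_left (by linarith)]; nlinarith
      · rw [max_eq_left hk, max_eq_right (by linarith)]; simp
    simp only [Set.mem_ofPred_eq, clusterGauge] at hx1
    nlinarith

/-! ### The polynomials and their recurrences -/

open Polynomial Set

/-- The polynomials `∑ i ≤ n, binom (2 n - i) n * X ^ i / i!`. -/
noncomputable def rootPoly (n : ℕ) : ℝ[X] :=
  ∑ i ∈ Finset.range (n + 1), C (((2 * n - i).choose n : ℝ) / (i ! : ℝ)) * X ^ i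

lemma coeff_rootPoly (n i : ℕ) :
    (rootPoly n).coeff i = if i ≤ n then ((2 * n - i).choose n : ℝ) / (i ! : ℝ) else 0 := by
  simp [rootPoly]

lemma coeff_derivative_rootPoly (n i : ℕ) : (derivative (rootPoly n)).coeff i =
    if i + 1 ≤ n then ((2 * n - (i + 1)).choose n : ℝ) / (i ! : ℝ) else 0 := by
  rw [coeff_derivative, coeff_rootPoly]
  split_ifs
  · rw [Nat.factorial_succ]
    have : (i ! : ℝ) ≠ 0 := by positivity
    have : (i : ℝ) + 1 ≠ 0 := by positivity
    push_cast
    field_simp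
  · simp

lemma coeff_derivative_derivative_rootPoly (n i : ℕ) :
    (derivative (derivative (rootPoly n))).coeff i =
    if i + 2 ≤ n then ((2 * n - (i + 2)).choose n : ℝ) / (i ! : ℝ) else 0 := by
  rw [coeff_derivative, coeff_derivative_rootPoly]
  split_ifs
  · rw [Nat.factorial_succ]
    have : (i ! : ℝ) ≠ 0 := by positivity
    have : (i : ℝ) + 1 ≠ 0 := by positivity
    push_cast
    field_simp
  · simp

lemma rootPoly_zero : rootPoly 0 = 1 := by simp [rootPoly]

/-- Differentiation shifts the coefficient index, so this is Pascal's rule. -/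
lemma derivative_rootPoly_sub (n : ℕ) :
    derivative (rootPoly (n + 1)) - derivative (derivative (rootPoly (n + 1))) = rootPoly n := by
  ext i
  rw [coeff_sub, coeff_derivative_rootPoly, coeff_derivative_derivative_rootPoly, coeff_rootPoly]
  by_cases h : i ≤ n
  · have h1 : 2 * (n + 1) - (i + 1) = (2 * n - i) + 1 := by omega
    have h2 : 2 * (n + 1) - (i + 2) = 2 * n - i := by omega
    rw [if_pos (by omega), if_pos h, h1, h2, Nat.choose_succ_succ]
    split_ifs with h3
    · push_cast; ring
    -- Here `i = n`: the second derivative has no such term, and the matching binomial coefficient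
    -- vanishes.
    · have : (2 * n - i).choose (n + 1) = 0 := Nat.choose_eq_zero_of_lt (by omega)
      simp [this]
  · rw [if_neg (by omega), if_neg (by omega), if_neg h, sub_zero]

lemma rootPoly_eval_zero (n : ℕ) : (rootPoly n).eval 0 = (2 * n).choose n := by
  rw [← coeff_zero_eq_eval_zero, coeff_rootPoly]; simp

lemma rootPoly_succ_eval_zero (n : ℕ) :
    (rootPoly (n + 1)).eval 0 = 2 * (derivative (rootPoly (n + 1))).eval 0 := by
  rw [rootPoly_eval_zero, ← coeff_zero_eq_eval_zero, coeff_derivative_rootPoly,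
    if_pos (by omega)]
  have h : 2 * (n + 1) = (2 * n + 1) + 1 := by ring
  rw [h, Nat.choose_succ_succ, ← Nat.choose_symm_half]
  simp
  ring

/-- The analogue of `rootPoly` for the polytope of positive roots. -/
noncomputable def positivePoly (n : ℕ) : ℝ[X] :=
  derivative (rootPoly (n + 1)) - 2 * derivative (derivative (rootPoly (n + 1)))

/-- The recurrence survives any constant-coefficient differential operator applied to the whole
family. -/
lemma derivative_positivePoly_sub (n : ℕ) :
    derivative (positivePoly (n + 1)) - derivative (derivative (positivePoly (n + 1))) =
      positivePoly n := by
  have h : ∀ p : ℝ[X], derivative (2 * p) = 2 * derivative p := fun p => by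
    rw [derivative_mul]; simp
  rw [positivePoly, positivePoly, ← derivative_rootPoly_sub (n + 1)]
  simp only [derivative_sub, h]
  ring

/-- This explains the combination in `positivePoly`: with `R = rootPoly (n + 1)`, the difference of
the two sides reduces to `R(0) - 2 R'(0) = 0`. -/
lemma positivePoly_succ_eval_zero (n : ℕ) :
    (positivePoly (n + 1)).eval 0 = (derivative (positivePoly (n + 1))).eval 0 := by
  have h : ∀ p : ℝ[X], derivative (2 * p) = 2 * derivative p := fun p => by
    rw [derivative_mul]; simp
  have h1 := rootPoly_succ_eval_zero n
  rw [← derivative_rootPoly_sub (n + 1)] at h1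
  simp only [positivePoly, derivative_sub, h, eval_sub, eval_mul, eval_ofNat] at *
  linarith

lemma positivePoly_eval_zero (n : ℕ) : (positivePoly n).eval 0 = catalan n := by
  have h : ∀ p : ℝ[X], eval 0 (2 * p) = 2 * eval 0 p := fun p => by simp
  have h0 : (if 0 + 2 ≤ n + 1 then ((2 * (n + 1) - (0 + 2)).choose (n + 1) : ℝ) / (0 ! : ℝ) else 0)
      = (2 * n).choose (n + 1) := by
    split_ifs with h
    · simp [mul_add]
    · obtain rfl : n = 0 := by omega
      simp
  have h1 : 2 * (n + 1) - (0 + 1) = 2 * n + 1 := by omega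
  rw [positivePoly, eval_sub, h, ← coeff_zero_eq_eval_zero, ← coeff_zero_eq_eval_zero,
    coeff_derivative_rootPoly, coeff_derivative_derivative_rootPoly, h0, if_pos (by omega), h1,
    Nat.choose_succ_succ]
  have h2 : ((n + 1) * catalan n : ℝ) = (2 * n).choose n := by
    exact_mod_cast succ_mul_catalan_eq_centralBinom n
  have h3 : ((2 * n).choose (n + 1) * (n + 1) : ℝ) = (2 * n).choose n * n := by
    have := Nat.choose_succ_right_eq (2 * n) n
    rw [show 2 * n - n = n by omega] at this
    exact_mod_cast this
  have h4 : (n : ℝ) + 1 ≠ 0 := by positivity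
  apply mul_left_cancel₀ h4
  push_cast
  simp only [Nat.factorial_zero, Nat.cast_one, div_one]
  linarith

lemma positivePoly_zero : positivePoly 0 = 1 := by
  have h1 : derivative (rootPoly 1) - derivative (derivative (rootPoly 1)) = rootPoly 0 :=
    derivative_rootPoly_sub 0
  have h2 : derivative (derivative (rootPoly 1)) = 0 := by
    ext i
    rw [coeff_derivative_derivative_rootPoly, if_neg (by omega), coeff_zero]
  rw [h2, sub_zero, rootPoly_zero] at h1
  rw [positivePoly, zero_add, h2, h1]
  simp

lemma derivative_positivePoly_one : derivative (positivePoly 1) = 1 := by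
  have h1 : derivative (positivePoly 1) - derivative (derivative (positivePoly 1)) =
    positivePoly 0 := derivative_positivePoly_sub 0
  have h2 : derivative (derivative (derivative (rootPoly 2))) = 0 := by
    ext i
    rw [coeff_derivative, coeff_derivative_derivative_rootPoly, if_neg (by omega), zero_mul,
      coeff_zero]
  have h3 : derivative (derivative (positivePoly 1)) = 0 := by
    rw [positivePoly, show (1 + 1 : ℕ) = 2 from rfl]
    simp [derivative_mul, h2]
  rw [h3, sub_zero, positivePoly_zero] at h1
  exact h1

/-! ### Integrating out one coordinate at a time -/

/-- The integrand has antiderivative `-exp (-(b - a)) * G b`. The sign statement is carried along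
because splitting `ENNReal.ofReal` of a sum needs it. -/
lemma lintegral_Ioi_exp_mul_poly {G P : ℝ[X]} (h : G - derivative G = P) {a : ℝ}
    (hP : ∀ b, a ≤ b → 0 ≤ P.eval b) :
    ∫⁻ b in Ioi a, ENNReal.ofReal (Real.exp (-(b - a))) * ENNReal.ofReal (P.eval b) =
      ENNReal.ofReal (G.eval a) ∧ 0 ≤ G.eval a := by
  have hderiv : ∀ b ∈ Ici a, HasDerivAt (fun b => -(Real.exp (-(b - a)) * G.eval b))
      (Real.exp (-(b - a)) * P.eval b) b := by
    intro b _
    have h1 : HasDerivAt (fun b : ℝ => Real.exp (-(b - a))) (Real.exp (-(b - a)) * -1) b :=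
      (((hasDerivAt_id b).sub_const a).neg).exp
    have := (h1.mul (G.hasDerivAt b)).neg
    refine this.congr_deriv ?_
    rw [← h, eval_sub]; ring
  have hpos : ∀ b ∈ Ioi a, 0 ≤ Real.exp (-(b - a)) * P.eval b := fun b hb =>
    mul_nonneg (Real.exp_pos _).le (hP b (le_of_lt hb))
  have hlim : Filter.Tendsto (fun b => -(Real.exp (-(b - a)) * G.eval b)) Filter.atTop
      (nhds 0) := by
    have := ((tendsto_div_exp_atTop G).const_mul (Real.exp a)).neg
    rw [mul_zero, neg_zero] at this
    refine this.congr fun b => ?_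
    rw [neg_sub, Real.exp_sub]; ring
  have hint := integrableOn_Ioi_deriv_of_nonneg' hderiv hpos hlim
  have hval := integral_Ioi_of_hasDerivAt_of_nonneg' hderiv hpos hlim
  simp only [sub_self, neg_zero, Real.exp_zero, one_mul, sub_neg_eq_add, zero_add] at hval
  have hnn : 0 ≤ G.eval a := hval ▸ setIntegral_nonneg measurableSet_Ioi hpos
  refine ⟨?_, hnn⟩
  rw [← hval, ofReal_integral_eq_lintegral_ofReal hint
    ((ae_restrict_iff' measurableSet_Ioi).2 (Filter.Eventually.of_forall hpos))]
  exact lintegral_congr fun b => (ENNReal.ofReal_mul (Real.exp_pos _).le).symm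

/-- Split at `b = a`: below, the kernel is `1` and `Q - Q'` is an antiderivative of `P`; above, the
exponential tail equals `Q' a`. -/
lemma lintegral_Ioi_zero_kernel_mul_poly {Q P : ℝ[X]}
    (h : derivative Q - derivative (derivative Q) = P) (hP : ∀ b, 0 ≤ b → 0 ≤ P.eval b)
    {a : ℝ} (ha : 0 ≤ a) :
    ∫⁻ b in Ioi 0, ENNReal.ofReal (Real.exp (-max (b - a) 0)) * ENNReal.ofReal (P.eval b) =
      ENNReal.ofReal (Q.eval a - Q.eval 0 + (derivative Q).eval 0) ∧
    0 ≤ Q.eval a - Q.eval 0 + (derivative Q).eval 0 := by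
  obtain ⟨h1, h1'⟩ := lintegral_Ioi_exp_mul_poly h (a := a) fun b hb => hP b (ha.trans hb)
  have hval : ∫ b in (0 : ℝ)..a, P.eval b =
      (Q - derivative Q).eval a - (Q - derivative Q).eval 0 :=
    intervalIntegral.integral_eq_sub_of_hasDerivAt
      (fun b _ => by
        have := (Q - derivative Q).hasDerivAt b
        rwa [derivative_sub, h] at this)
      (P.continuous.intervalIntegrable _ _)
  rw [intervalIntegral.integral_of_le ha] at hval
  have hpos : ∀ b ∈ Ioc 0 a, 0 ≤ P.eval b := fun b hb => hP b hb.1.le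
  have h2 : ∫⁻ b in Ioc 0 a, ENNReal.ofReal (P.eval b) = ENNReal.ofReal
      ((Q - derivative Q).eval a - (Q - derivative Q).eval 0) := by
    rw [← hval, ofReal_integral_eq_lintegral_ofReal
      ((P.continuous.integrableOn_Icc).mono_set Ioc_subset_Icc_self)
      ((ae_restrict_iff' measurableSet_Ioc).2 (Filter.Eventually.of_forall hpos))]
  have h2' : 0 ≤ (Q - derivative Q).eval a - (Q - derivative Q).eval 0 :=
    hval ▸ setIntegral_nonneg measurableSet_Ioc hpos
  have h3 : Q.eval a - Q.eval 0 + (derivative Q).eval 0 =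
      ((Q - derivative Q).eval a - (Q - derivative Q).eval 0) + (derivative Q).eval a := by
    simp only [eval_sub]; ring
  rw [h3]
  refine ⟨?_, add_nonneg h2' h1'⟩
  rw [← Ioc_union_Ioi_eq_Ioi ha, lintegral_union measurableSet_Ioi
    (Set.disjoint_left.2 fun b hb hb' => not_lt.2 hb.2 hb'), ENNReal.ofReal_add h2' h1', ← h1, ← h2]
  congr 1
  · refine setLIntegral_congr_fun measurableSet_Ioc fun b hb => ?_
    rw [max_eq_right (by linarith [hb.2])]; simp
  · refine setLIntegral_congr_fun measurableSet_Ioi fun b hb => ?_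
    rw [max_eq_left (by linarith [mem_Ioi.1 hb])]

lemma lintegral_fin_succ {n : ℕ} {F : (Fin (n + 1) → ℝ) → ℝ≥0∞} (hF : Measurable F) :
    ∫⁻ x, F x = ∫⁻ b : ℝ, ∫⁻ x : Fin n → ℝ, F (Fin.cons b x) := by
  have h := (volume_preserving_piFinSuccAbove (fun _ : Fin (n + 1) => ℝ) 0).symm
  rw [← h.lintegral_comp hF, Measure.volume_eq_prod, lintegral_prod _ (by
    exact (hF.comp (MeasurableEquiv.measurable _)).aemeasurable)]
  simp [MeasurableEquiv.piFinSuccAbove_symm_apply, Fin.insertNthEquiv]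

lemma lintegral_eq_Iic_add_Ioi (F : ℝ → ℝ≥0∞) :
    ∫⁻ b, F b = (∫⁻ b in Iic 0, F b) + ∫⁻ b in Ioi 0, F b := by
  rw [← lintegral_add_compl F measurableSet_Iic, compl_Iic]

lemma lintegral_Iic_comp_neg {F : ℝ → ℝ≥0∞} :
    ∫⁻ b in Iic 0, F (-b) = ∫⁻ b in Ioi 0, F b := by
  have h := (Measure.measurePreserving_neg (volume : Measure ℝ)).setLIntegral_comp_preimage_emb
    (MeasurableEquiv.neg ℝ).measurableEmbedding F (Ici 0)
  rw [setLIntegral_congr Ioi_ae_eq_Ici, ← h]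
  congr 2
  ext; simp

lemma measurable_exp_neg_ascent {n : ℕ} (a : ℝ) :
    Measurable fun x : Fin n → ℝ => ENNReal.ofReal (Real.exp (-ascent a x)) := by
  have := continuous_ascent (n := n)
  have h : Continuous fun x : Fin n → ℝ => ascent a x :=
    this.comp (f := fun x => (a, x)) (by fun_prop)
  exact (Real.continuous_exp.comp h.neg).measurable.ennreal_ofReal

lemma exp_neg_ascent_cons {n : ℕ} (a b : ℝ) (x : Fin n → ℝ) :
    ENNReal.ofReal (Real.exp (-ascent a (Fin.cons b x : Fin (n + 1) → ℝ))) =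
      ENNReal.ofReal (Real.exp (-max (b - a) 0)) * ENNReal.ofReal (Real.exp (-ascent b x)) := by
  rw [ascent_succ, ← ENNReal.ofReal_mul (Real.exp_pos _).le, ← Real.exp_add]
  simp only [Fin.cons_zero, Fin.tail_cons]
  congr 2; ring

lemma lintegral_exp_neg_ascent_neg {n : ℕ} (a : ℝ) :
    ∫⁻ x : Fin n → ℝ, ENNReal.ofReal (Real.exp (-ascent (-a) x)) =
      ENNReal.ofReal (Real.exp (-a)) *
        ∫⁻ x : Fin n → ℝ, ENNReal.ofReal (Real.exp (-ascent a x)) := by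
  rw [← (Measure.measurePreserving_neg (volume : Measure (Fin n → ℝ))).lintegral_comp
    (measurable_exp_neg_ascent _), ← lintegral_const_mul _ (measurable_exp_neg_ascent _)]
  refine lintegral_congr fun x => ?_
  rw [ascent_neg, ← ENNReal.ofReal_mul (Real.exp_pos _).le, ← Real.exp_add]
  congr 2; ring

/-- Integrate over the first entry `b`. For `b ≤ 0` the step from `a ≥ 0` is free, and reflecting
the rest of the path gives a factor `exp b`; this half contributes `Q' 0` for `Q = rootPoly (n +
1)`, whence the condition `Q 0 = 2 * Q' 0`. -/
lemma lintegral_exp_neg_ascent (n : ℕ) {a : ℝ} (ha : 0 ≤ a) :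
    ∫⁻ x : Fin n → ℝ, ENNReal.ofReal (Real.exp (-ascent a x)) =
      ENNReal.ofReal ((rootPoly n).eval a) ∧ 0 ≤ (rootPoly n).eval a := by
  induction n generalizing a with
  | zero =>
    simp [ascent_zero_dim, rootPoly_zero, ha, volume_pi]
  | succ n ih =>
    obtain ⟨h1, h1'⟩ := lintegral_Ioi_zero_kernel_mul_poly (derivative_rootPoly_sub n)
      (fun b hb => (ih hb).2) ha
    obtain ⟨h2, h2'⟩ := lintegral_Ioi_exp_mul_poly (derivative_rootPoly_sub n) (a := 0)
      (fun b hb => (ih hb).2)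
    have h0 := rootPoly_succ_eval_zero n
    have heq : (rootPoly (n + 1)).eval a = (derivative (rootPoly (n + 1))).eval 0 +
      (eval a (rootPoly (n + 1)) - eval 0 (rootPoly (n + 1)) +
        eval 0 (derivative (rootPoly (n + 1)))) := by linarith
    rw [heq]
    refine ⟨?_, add_nonneg h2' h1'⟩
    rw [lintegral_fin_succ (measurable_exp_neg_ascent a), lintegral_eq_Iic_add_Ioi,
      ENNReal.ofReal_add h2' h1', ← h1, ← h2, ← lintegral_Iic_comp_neg (F := fun b =>
        ENNReal.ofReal (Real.exp (-(b - 0))) * ENNReal.ofReal ((rootPoly n).eval b))]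
    simp only [exp_neg_ascent_cons]
    congr 1
    · refine setLIntegral_congr_fun measurableSet_Iic fun b hb => ?_
      have hb' : 0 ≤ -b := by linarith [mem_Iic.1 hb]
      rw [lintegral_const_mul _ (measurable_exp_neg_ascent b), max_eq_right (by linarith)]
      have := lintegral_exp_neg_ascent_neg (n := n) (-b)
      rw [neg_neg] at this
      rw [this, (ih hb').1]
      simp
    · refine setLIntegral_congr_fun measurableSet_Ioi fun b hb => ?_
      rw [lintegral_const_mul _ (measurable_exp_neg_ascent b), (ih (le_of_lt hb)).1]

lemma measurableSet_nonneg (n : ℕ) : MeasurableSet {x : Fin n → ℝ | 0 ≤ x} :=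
  (isClosed_Ici (a := (0 : Fin n → ℝ))).measurableSet

/-- Only `b ≥ 0` occurs now, so the condition at `0` becomes `Q 0 = Q' 0`. -/
lemma setLIntegral_nonneg_exp_neg_ascent (n : ℕ) {a : ℝ} (ha : 0 ≤ a) :
    ∫⁻ x in {x : Fin n → ℝ | 0 ≤ x}, ENNReal.ofReal (Real.exp (-ascent a x)) =
      ENNReal.ofReal ((positivePoly n).eval a) ∧ 0 ≤ (positivePoly n).eval a := by
  induction n generalizing a with
  | zero =>
    simp [ascent_zero_dim, positivePoly_zero, ha, volume_pi]
  | succ n ih =>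
    obtain ⟨h1, h1'⟩ := lintegral_Ioi_zero_kernel_mul_poly (derivative_positivePoly_sub n)
      (fun b hb => (ih hb).2) ha
    have h0 := positivePoly_succ_eval_zero n
    have heq : (positivePoly (n + 1)).eval a =
      (eval a (positivePoly (n + 1)) - eval 0 (positivePoly (n + 1)) +
        eval 0 (derivative (positivePoly (n + 1)))) := by linarith
    rw [heq]
    refine ⟨?_, h1'⟩
    rw [← lintegral_indicator (measurableSet_nonneg _), lintegral_fin_succ
      ((measurable_exp_neg_ascent a).indicator (measurableSet_nonneg _)), ← h1,
      setLIntegral_congr Ioi_ae_eq_Ici, ← lintegral_indicator measurableSet_Ici]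
    refine lintegral_congr fun b => ?_
    by_cases hb : 0 ≤ b
    · rw [indicator_of_mem (mem_Ici.2 hb), ← (ih hb).1,
        ← lintegral_const_mul _ (measurable_exp_neg_ascent b),
        ← lintegral_indicator (measurableSet_nonneg _)]
      refine lintegral_congr fun x => ?_
      have : (Fin.cons b x : Fin (n + 1) → ℝ) ∈ {x : Fin (n + 1) → ℝ | 0 ≤ x} ↔
          x ∈ {x : Fin n → ℝ | 0 ≤ x} :=
        ⟨fun h i => by simpa using h i.succ, fun h i => by
          refine Fin.cases ?_ (fun i => ?_) i
          · simpa using hb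
          · simpa using h i⟩
      by_cases hx : x ∈ {x : Fin n → ℝ | 0 ≤ x}
      · rw [indicator_of_mem (this.2 hx), indicator_of_mem hx, exp_neg_ascent_cons]
      · rw [indicator_of_notMem (mt this.1 hx), indicator_of_notMem hx]
    · rw [indicator_of_notMem (by simpa using hb)]
      refine (lintegral_congr fun x => indicator_of_notMem (fun h => hb ?_) _).trans
        lintegral_zero
      simpa using h 0

lemma continuous_ascent_max_add {n : ℕ} (a : ℝ) :
    Continuous fun x : Fin n → ℝ => ascent a (fun i => max (x i) 0) + ∑ i, max (-x i) 0 := by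
  have h : Continuous fun x : Fin n → ℝ => ascent a (fun i => max (x i) 0) :=
    continuous_ascent.comp (f := fun x : Fin n → ℝ => (a, fun i => max (x i) 0)) (by fun_prop)
  fun_prop

/-- A first entry `b ≤ 0` costs `-b` and restarts the path at `0`, so that half contributes the
previous polynomial's value at `0`, the integral of `exp` over `b ≤ 0` being `1`. -/
lemma lintegral_exp_neg_ascent_max_add (n : ℕ) {a : ℝ} (ha : 0 ≤ a) :
    ∫⁻ x : Fin n → ℝ, ENNReal.ofReal
        (Real.exp (-(ascent a (fun i => max (x i) 0) + ∑ i, max (-x i) 0))) =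
      ENNReal.ofReal ((derivative (positivePoly (n + 1))).eval a) ∧
      0 ≤ (derivative (positivePoly (n + 1))).eval a := by
  have hm : ∀ (n : ℕ) (a : ℝ), Measurable fun x : Fin n → ℝ => ENNReal.ofReal
        (Real.exp (-(ascent a (fun i => max (x i) 0) + ∑ i, max (-x i) 0))) := fun n a => by
    exact (Real.continuous_exp.comp (continuous_ascent_max_add a).neg).measurable.ennreal_ofReal
  induction n generalizing a with
  | zero =>
    simp [ascent_zero_dim, derivative_positivePoly_one, ha, volume_pi]
  | succ n ih =>
    have hrec := derivative_positivePoly_sub (n + 1)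
    have hrec' := congrArg derivative hrec
    rw [derivative_sub] at hrec'
    obtain ⟨h1, h1'⟩ := lintegral_Ioi_zero_kernel_mul_poly hrec' (fun b hb => (ih hb).2) ha
    have h2' := (ih le_rfl).2
    have h0 := positivePoly_succ_eval_zero n
    have heq : (derivative (positivePoly (n + 2))).eval a =
        (derivative (positivePoly (n + 1))).eval 0 +
        (eval a (derivative (positivePoly (n + 2))) - eval 0 (derivative (positivePoly (n + 2))) +
        eval 0 (derivative (derivative (positivePoly (n + 2))))) := by
      have := congrArg (eval 0) hrec
      rw [eval_sub] at this
      linarith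
    rw [heq]
    refine ⟨?_, add_nonneg h2' h1'⟩
    have hexp : ∫⁻ b in Iic (0 : ℝ), ENNReal.ofReal (Real.exp b) = 1 := by
      rw [← ofReal_integral_eq_lintegral_ofReal (integrableOn_exp_Iic 0)
        (Filter.Eventually.of_forall fun b => (Real.exp_pos b).le), integral_exp_Iic]
      simp
    have hcons : ∀ (b : ℝ) (x : Fin n → ℝ), ENNReal.ofReal (Real.exp (-(ascent a
        (fun i => max ((Fin.cons b x : Fin (n + 1) → ℝ) i) 0) +
          ∑ i, max (-(Fin.cons b x : Fin (n + 1) → ℝ) i) 0))) =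
        ENNReal.ofReal (Real.exp (-(max (max b 0 - a) 0 + max (-b) 0))) * ENNReal.ofReal
        (Real.exp (-(ascent (max b 0) (fun i => max (x i) 0) + ∑ i, max (-x i) 0))) := by
      intro b x
      rw [ascent_succ, ← ENNReal.ofReal_mul (Real.exp_pos _).le, ← Real.exp_add,
        Fin.sum_univ_succ]
      unfold Fin.tail
      simp only [Fin.cons_zero, Fin.cons_succ]
      congr 2; ring
    rw [lintegral_fin_succ (hm _ a), lintegral_eq_Iic_add_Ioi,
      ENNReal.ofReal_add h2' h1', ← h1, ← one_mul (ENNReal.ofReal (eval 0 _)), ← hexp,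
      ← lintegral_mul_const _ (by fun_prop)]
    simp only [hcons]
    congr 1
    · refine setLIntegral_congr_fun measurableSet_Iic fun b hb => ?_
      have hb' : b ≤ 0 := hb
      rw [lintegral_const_mul _ (hm _ _), max_eq_right hb', (ih le_rfl).1,
        max_eq_right (by linarith), max_eq_left (by linarith)]
      simp
    · refine setLIntegral_congr_fun measurableSet_Ioi fun b hb => ?_
      have hb' : 0 ≤ b := le_of_lt hb
      rw [lintegral_const_mul _ (hm _ _), max_eq_left hb', (ih hb').1,
        max_eq_right (by linarith : -b ≤ 0), add_zero]

/-! ### Volume as an exponential integral -/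

open scoped Pointwise

lemma lintegral_Ioi_exp_neg_mul_pow (n : ℕ) :
    ∫⁻ t in Ioi (0 : ℝ), ENNReal.ofReal (Real.exp (-t)) * ENNReal.ofReal (t ^ n) =
      (n ! : ℝ≥0∞) := by
  have h0 : (0 : ℝ) < (n : ℝ) + 1 := by positivity
  have h := Real.Gamma_nat_eq_factorial n
  rw [Real.Gamma_eq_integral h0] at h
  rw [← ENNReal.ofReal_natCast, ← h, ofReal_integral_eq_lintegral_ofReal
    (Real.GammaIntegral_convergent h0) ((ae_restrict_iff' measurableSet_Ioi).2
      (Filter.Eventually.of_forall fun t ht =>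
        mul_nonneg (Real.exp_pos _).le (Real.rpow_nonneg (le_of_lt ht) _)))]
  refine setLIntegral_congr_fun measurableSet_Ioi fun t ht => ?_
  rw [← ENNReal.ofReal_mul (Real.exp_pos _).le, add_sub_cancel_right, Real.rpow_natCast]

lemma lintegral_Ici_exp_neg (c : ℝ) :
    ∫⁻ t in Ici c, ENNReal.ofReal (Real.exp (-t)) = ENNReal.ofReal (Real.exp (-c)) := by
  rw [setLIntegral_congr Ioi_ae_eq_Ici.symm, ← integral_exp_neg_Ioi c,
    ofReal_integral_eq_lintegral_ofReal (integrableOn_exp_neg_Ioi c)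
      (Filter.Eventually.of_forall fun t => (Real.exp_pos _).le)]

/-- The normalised volume of the unit ball of a gauge on a cone, as an exponential integral. -/
lemma integralVolume_gauge {n : ℕ} {K : Set (Fin n → ℝ)} {g : (Fin n → ℝ) → ℝ}
    (hg : Measurable g) (hg0 : ∀ x ∈ K, 0 ≤ g x)
    (hKt : ∀ t : ℝ, 0 ≤ t → ∀ x ∈ K, t • x ∈ K)
    (hgt : ∀ t : ℝ, 0 ≤ t → ∀ x, g (t • x) = t * g x) :
    integralVolume (K ∩ {x | g x ≤ 1}) =
      ∫⁻ x in K, ENNReal.ofReal (Real.exp (-g x)) := by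
  have hset : ∀ t : ℝ, 0 < t → K ∩ {x | g x ≤ t} = t • (K ∩ {x | g x ≤ 1}) := by
    intro t ht
    ext x
    rw [mem_smul_set_iff_inv_smul_mem₀ ht.ne']
    have h1 : t⁻¹ • x ∈ K ↔ x ∈ K :=
      ⟨fun h => by simpa [smul_smul, ht.ne'] using hKt t ht.le _ h,
        hKt t⁻¹ (inv_nonneg.2 ht.le) x⟩
    have h2 : g (t⁻¹ • x) ≤ 1 ↔ g x ≤ t := by
      rw [hgt _ (inv_nonneg.2 ht.le), inv_mul_le_iff₀ ht, mul_one]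
    exact and_congr h1.symm h2.symm
  have hvol : ∀ t ∈ Ioi (0 : ℝ), volume (K ∩ {x | g x ≤ t}) =
      ENNReal.ofReal (t ^ n) * volume (K ∩ {x | g x ≤ 1}) := by
    intro t ht
    rw [hset t ht, Measure.addHaar_smul_of_nonneg _ (le_of_lt ht)]
    simp
  -- Layer cake: `exp (-g x)` is the integral of `exp (-t)` over `t ≥ g x`. After swapping,
  -- homogeneity gives `t ^ n` and the Gamma integral supplies `n !`.
  have hlayer : ∀ x, ENNReal.ofReal (Real.exp (-g x)) =
      ∫⁻ t : ℝ, {p : (Fin n → ℝ) × ℝ | g p.1 ≤ p.2}.indicator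
        (fun p => ENNReal.ofReal (Real.exp (-p.2))) (x, t) := by
    intro x
    rw [← lintegral_Ici_exp_neg, ← lintegral_indicator measurableSet_Ici]
    rfl
  have hmeas : Measurable ({p : (Fin n → ℝ) × ℝ | g p.1 ≤ p.2}.indicator
        (fun p => ENNReal.ofReal (Real.exp (-p.2)))) :=
    Measurable.indicator (by fun_prop)
      (measurableSet_le (hg.comp measurable_fst) measurable_snd)
  have hinner : ∀ t : ℝ, ∫⁻ x in K, {p : (Fin n → ℝ) × ℝ | g p.1 ≤ p.2}.indicator
        (fun p => ENNReal.ofReal (Real.exp (-p.2))) (x, t) =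
      ENNReal.ofReal (Real.exp (-t)) * volume (K ∩ {x | g x ≤ t}) := by
    intro t
    have hm : MeasurableSet {x | g x ≤ t} := measurableSet_le hg measurable_const
    rw [inter_comm, ← Measure.restrict_apply hm, ← lintegral_indicator_const hm]
    rfl
  have hneg : ∫⁻ t in Iic (0 : ℝ), ENNReal.ofReal (Real.exp (-t)) * volume (K ∩ {x | g x ≤ t})
      = 0 := by
    rw [setLIntegral_congr Iio_ae_eq_Iic.symm]
    refine (setLIntegral_congr_fun measurableSet_Iio fun t ht => ?_).trans lintegral_zero
    have : K ∩ {x | g x ≤ t} = ∅ := by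
      ext x
      simp only [mem_inter_iff, mem_ofPred_eq, mem_empty_iff_false, iff_false, not_and, not_le]
      exact fun hx => lt_of_lt_of_le ht (hg0 x hx)
    rw [this, measure_empty, mul_zero]
  simp_rw [hlayer]
  rw [lintegral_lintegral_swap (f := fun x t => {p : (Fin n → ℝ) × ℝ | g p.1 ≤ p.2}.indicator
    (fun p => ENNReal.ofReal (Real.exp (-p.2))) (x, t)) hmeas.aemeasurable]
  simp_rw [hinner]
  rw [lintegral_eq_Iic_add_Ioi, hneg, zero_add, integralVolume, ← lintegral_Ioi_exp_neg_mul_pow,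
    ← lintegral_mul_const _ (by fun_prop)]
  exact setLIntegral_congr_fun measurableSet_Ioi fun t ht => by rw [hvol t ht, mul_assoc]

/-! ### The three volumes -/

lemma measurable_ascent_zero (n : ℕ) : Measurable fun x : Fin n → ℝ => ascent 0 x :=
  (continuous_ascent.comp (f := fun x : Fin n → ℝ => ((0 : ℝ), x)) (by fun_prop)).measurable

lemma integralVolume_polytopeC {n : ℕ} (hn : 1 ≤ n) :
    integralVolume (polytopeC n) = ((2 * n).choose n : ℝ≥0∞) := by
  have h := integralVolume_gauge (K := univ) (measurable_ascent_zero n)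
    (fun x _ => ascent_nonneg 0 x) (fun _ _ _ _ => mem_univ _) (fun t ht x => ascent_zero_smul ht x)
  rw [univ_inter, ← polytopeC_eq hn, Measure.restrict_univ,
    (lintegral_exp_neg_ascent n le_rfl).1, rootPoly_eval_zero] at h
  rw [h, ENNReal.ofReal_natCast]

lemma integralVolume_polytopeCplus (n : ℕ) :
    integralVolume (polytopeCplus n) = (catalan n : ℝ≥0∞) := by
  rw [polytopeCplus_eq, integralVolume_gauge (K := {x : Fin n → ℝ | 0 ≤ x})
    (measurable_ascent_zero n) (fun x _ => ascent_nonneg 0 x)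
    (fun t ht x hx => show (0 : Fin n → ℝ) ≤ t • x from smul_nonneg ht hx)
    (fun t ht x => ascent_zero_smul ht x),
    (setLIntegral_nonneg_exp_neg_ascent n le_rfl).1, positivePoly_eval_zero,
    ENNReal.ofReal_natCast]

lemma clusterGauge_smul {n : ℕ} {t : ℝ} (ht : 0 ≤ t) (x : Fin n → ℝ) :
    clusterGauge (t • x) = t * clusterGauge x := by
  have h : (fun i => max ((t • x) i) 0) = t • fun i => max (x i) 0 := by
    ext i
    simp [mul_max_of_nonneg _ _ ht]
  rw [clusterGauge, clusterGauge, h, ascent_zero_smul ht, mul_add, Finset.mul_sum]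
  congr 1
  exact Finset.sum_congr rfl fun i _ => by simp [mul_max_of_nonneg _ _ ht]

lemma integralVolume_polytopeCclus {n : ℕ} (hn : 1 ≤ n) :
    integralVolume (polytopeCclus n) = (catalan (n + 1) : ℝ≥0∞) := by
  have h := integralVolume_gauge (K := univ) (g := clusterGauge (n := n))
    (continuous_ascent_max_add 0).measurable
    (fun x _ => add_nonneg (ascent_nonneg _ _) (Finset.sum_nonneg fun i _ => le_max_right _ _))
    (fun _ _ _ _ => mem_univ _) (fun t ht x => clusterGauge_smul ht x)
  rw [univ_inter, ← polytopeCclus_eq hn, Measure.restrict_univ] at h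
  rw [h]
  refine (lintegral_exp_neg_ascent_max_add n le_rfl).1.trans ?_
  rw [← positivePoly_succ_eval_zero, positivePoly_eval_zero, ENNReal.ofReal_natCast]

lemma catalan_eq_choose_div (n : ℕ) :
    (catalan n : ℝ≥0∞) = ((2 * n).choose n : ℝ≥0∞) / ((n : ℝ≥0∞) + 1) := by
  rw [ENNReal.eq_div_iff (by simp) (by finiteness)]
  exact_mod_cast succ_mul_catalan_eq_centralBinom n

end RootPolytopeA

theorem mainTheorem3 (n : ℕ) (hn : 1 ≤ n) :
    (RootPolytopeA.integralVolume (RootPolytopeA.polytopeC n)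
        = ((2 * n).choose n : ℝ≥0∞) ∧
      RootPolytopeA.integralVolume (RootPolytopeA.polytopeC n)
        = ((n : ℝ≥0∞) + 1) * (catalan n : ℝ≥0∞)) ∧
    (RootPolytopeA.integralVolume (RootPolytopeA.polytopeCclus n)
        = ((2 * n + 2).choose (n + 1) : ℝ≥0∞) / ((n : ℝ≥0∞) + 2) ∧
      RootPolytopeA.integralVolume (RootPolytopeA.polytopeCclus n)
        = (catalan (n + 1) : ℝ≥0∞)) ∧
    (RootPolytopeA.integralVolume (RootPolytopeA.polytopeCplus n)
        = ((2 * n).choose n : ℝ≥0∞) / ((n : ℝ≥0∞) + 1) ∧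
      RootPolytopeA.integralVolume (RootPolytopeA.polytopeCplus n)
        = (catalan n : ℝ≥0∞)) := by
  rw [RootPolytopeA.integralVolume_polytopeC hn, RootPolytopeA.integralVolume_polytopeCclus hn,
    RootPolytopeA.integralVolume_polytopeCplus]
  refine ⟨⟨rfl, ?_⟩, ⟨?_, rfl⟩, RootPolytopeA.catalan_eq_choose_div n, rfl⟩
  · exact_mod_cast (succ_mul_catalan_eq_centralBinom n).symm
  · have h := RootPolytopeA.catalan_eq_choose_div (n + 1)
    rw [mul_add, mul_one] at h
    rw [h]
    push_cast
    rw [add_assoc, one_add_one_eq_two]
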